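/- **Theorem 3.1 (Triangle Avoidance).** Let Sol be $\mathbf R^3$ with the Riemannian metric $e^{-2z}dx^2+e^{2z}dy^2+dz^2$, and let $E:\mathbf R^3=T_0\mathrm{Sol}\to\mathrm{Sol}$ be its Riemannian exponential map at the origin. For $V=(x,y,z)\in\mathbf R^3$ let $$\mu(V)=\mathrm{AGM}\Bigl(\sqrt{|xy|},\ \tfrac12\sqrt{(|x|+|y|)^2+z^2}\Bigr),$$ where $\mathrm{AGM}$ is the arithmetic-geometric mean, and let $\Pi$ be the plane $z=0$ in Sol. Put $$\partial_0N=\{E(V):V=(x,y,0),\ \mu(V)=\pi\}\subset\Pi,$$ and let $\partial N\subset\Pi$ be the closure of the set of points which $\partial_0N$ separates from the origin in $\Pi$, that is, of the points of $\Pi-\partial_0N$ which do not lie in the connected component of $\Pi-\partial_0N$ containing the origin. Let $\partial_0N_+$ and $\partial N_+$ be the sets of points $(x,y,z)$ of $\partial_0N$ and $\partial N$, respectively, with $x>0$ and $y>0$. Let $p=(a,b,0)\in\partial_0N_+$ with $a>b>0$, and let $\Delta(p)$ be the solid right triangle with vertices $(0,0,0)$, $(a,0,0)$ and $(a,b,0)$.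 Then $$\partial N_+\cap\Delta(p)=\{p\}.$$ -/

import Mathlib

namespace SolGeometry

noncomputable section

/-- The underlying space `ℝ³`, with coordinates `(x, y, z) = (p 0, p 1, p 2)`. It serves both as Sol
and as its Lie algebra, i.e. the tangent space of Sol at the origin. -/
abbrev R3 : Type := Fin 3 → ℝ

/-! ### Geodesics and the Riemannian exponential map of Sol -/

/-- The matrix of the left invariant metric `e^{-2z} dx² + e^{2z} dy² + dz²`. -/
def metric (p : R3) : Matrix (Fin 3) (Fin 3) ℝ :=
  Matrix.diagonal ![Real.exp (-2 * p 2), Real.exp (2 * p 2), 1]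

/-- The partial derivative of `f` in the `i`-th coordinate direction at `p`. -/
def partialDeriv (i : Fin 3) (f : R3 → ℝ) (p : R3) : ℝ :=
  fderiv ℝ f p (Pi.single i 1)

/-- The Christoffel symbol `Γᵏᵢⱼ` of the Levi-Civita connection of the metric. -/
def christoffel (k i j : Fin 3) (p : R3) : ℝ :=
  (1 / 2) * ∑ l, (metric p)⁻¹ k l *
    (partialDeriv i (fun q => metric q j l) p + partialDeriv j (fun q => metric q i l) p
      - partialDeriv l (fun q => metric q i j) p)

/-- `γ : ℝ → Sol` is a geodesic: it is twice differentiable and satisfies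
`γₖ'' + ∑ᵢⱼ Γᵏᵢⱼ(γ) γᵢ' γⱼ' = 0` for every `k`. -/
def IsGeodesic (γ : ℝ → R3) : Prop :=
  Differentiable ℝ γ ∧
    ∀ t, HasDerivAt (deriv γ)
      (fun k => -∑ i, ∑ j, christoffel k i j (γ t) * deriv γ t i * deriv γ t j) t

open Classical in
/-- The Riemannian exponential map `E` of Sol at the origin: `E(V) = γ(1)`, where `γ` is the geodesic
with `γ(0) = 0` and `γ'(0) = V`. (That geodesic exists on all of `ℝ`, the metric being homogeneous and
hence complete, and it is unique; the value in the `else` branch is never taken.) -/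
def expMap (V : R3) : R3 :=
  if h : ∃ γ : ℝ → R3, IsGeodesic γ ∧ γ 0 = 0 ∧ deriv γ 0 = V then h.choose 1 else 0

/-! ### Perfect vectors -/

/-- `μ(x,y,z) = AGM(√|xy|, ½ √((|x|+|y|)² + z²))`. -/
def mu (V : R3) : ℝ :=
  (NNReal.agm (Real.toNNReal (Real.sqrt |V 0 * V 1|))
    (Real.toNNReal ((1 / 2) * Real.sqrt ((|V 0| + |V 1|) ^ 2 + V 2 ^ 2))) : ℝ)

/-- `∂N'`: the set of perfect vectors in the Lie algebra. -/
def perfectVectors : Set R3 := {V | mu V = Real.pi}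

/-- The plane `z = 0` (called `Π` in Sol, and `Π'` in the Lie algebra). -/
def plane : Set R3 := {p | p 2 = 0}

/-- `∂₀N' = ∂N' ∩ Π'`. -/
def perfectVectors₀ : Set R3 := perfectVectors ∩ plane

/-! ### The sets `∂₀N` and `∂N` in Sol -/

/-- `∂₀N = E(∂₀N')`. -/
def bdry₀N : Set R3 := expMap '' perfectVectors₀

/-- The points of the plane `Π` which `∂₀N` separates from the origin: those in `Π - ∂₀N` which do not
lie in the connected component of the origin in `Π - ∂₀N`. -/
def separated : Set R3 :=
  {q | q ∈ plane \ bdry₀N ∧ q ∉ connectedComponentIn (plane \ bdry₀N) 0}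

/-- `∂N`: the closure of the set of points of `Π` which `∂₀N` separates from the origin. (As `Π` is
closed, it does not matter whether the closure is taken in `Π` or in Sol.) -/
def bdryN : Set R3 := closure separated

/-- `S₊`: the intersection of `S` with the positive sector `x, y > 0`. -/
def pos (S : Set R3) : Set R3 := S ∩ {p | 0 < p 0 ∧ 0 < p 1}

/-- The (solid) triangle with vertices `(0,0,0)`, `(a,0,0)`, `(a,b,0)`. -/
def triangle (a b : ℝ) : Set R3 :=
  convexHull ℝ {![0, 0, 0], ![a, 0, 0], ![a, b, 0]}

end

end SolGeometry

/-!
The theorem reduces to a monotonicity which is visible once the curve is written in the coordinates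
of its points.

A geodesic of Sol conserves `e^{-2z} x'` and `e^{2z} y'`. For the initial velocity `(X, Y, 0)` with
`X Y ≠ 0` all of it can be expressed through a phase `φ` with `φ' = √(X² cos² φ + Y² sin² φ)` and
`φ(0) = 0`; the height is `z = log (φ' / |X|)`, which vanishes when `φ` reaches `π`. This happens
after the time `∫₀^π dθ / √(X² cos² θ + Y² sin² θ)`, which is `π / AGM(|X|, |Y|)` by Gauss's formula
(`ellipticPeriod_eq_pi_div_agm`, proved with Landen's substitution). As `μ(X, Y, 0) = AGM(|X|, |Y|)`,
perfect horizontal vectors are those for which the time is `1`, and for them `expMap_horizontal`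
gives `E(X, Y, 0) = (S / X, S / Y, 0)`, where `S = halfPerimeter X Y` is half the perimeter of the
ellipse with semi-axes `|X|`, `|Y|`.

Both `AGM` and `halfPerimeter` are homogeneous of degree one, so the velocity can be eliminated:
`(x, y, 0)` with `x y ≠ 0` lies on the curve `∂₀N` if and only if `halfPerimeter y x = |x y|`
(`mem_bdry₀N_iff`). On a ray from the origin the left side grows linearly and the right side
quadratically. Hence `∂₀N` separates from the origin exactly the points of the plane with
`halfPerimeter y x < |x y|` (`mem_separated_iff`).

For `x, y > 0` the inequality `halfPerimeter y x ≤ |x y|` reads `halfPerimeter 1 (x / y) ≤ x`, and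
`v ↦ halfPerimeter 1 v` is strictly increasing. If `(a, b, 0)` lies on the curve, then
`a = halfPerimeter 1 (a / b)`; a point of the triangle has `x ≤ a` and `x / y ≥ a / b`, so that it
can satisfy the inequality only if it is `(a, b, 0)`.
-/

namespace SolGeometry

open Real Set Filter Topology

/-! ### The geodesic equations -/

lemma metric_inv (p : R3) :
    (metric p)⁻¹ = Matrix.diagonal ![exp (2 * p 2), exp (-2 * p 2), 1] := by
  refine Matrix.inv_eq_right_inv ?_
  rw [metric, Matrix.diagonal_mul_diagonal, ← Matrix.diagonal_one]
  congr 1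
  funext i
  fin_cases i <;> simp [← exp_add]

lemma partialDeriv_const (i : Fin 3) (c : ℝ) (p : R3) :
    partialDeriv i (fun _ => c) p = 0 := by
  simp [partialDeriv]

lemma partialDeriv_exp (i : Fin 3) (c : ℝ) (p : R3) :
    partialDeriv i (fun q => exp (c * q 2)) p = if i = 2 then c * exp (c * p 2) else 0 := by
  have h : HasFDerivAt (fun q : R3 => exp (c * q 2))
      (exp (c * p 2) • c • ContinuousLinearMap.proj (R := ℝ) (φ := fun _ : Fin 3 => ℝ) 2) p :=
    ((hasFDerivAt_apply (𝕜 := ℝ) (2 : Fin 3) p).const_mul c).exp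
  rw [partialDeriv, h.fderiv]
  fin_cases i <;> simp [mul_comm]

/-- The acceleration `-Γ(p)(u, u)` of a geodesic through `p` with velocity `u`. -/
noncomputable def geodesicAccel (p u : R3) : R3 :=
  ![2 * u 0 * u 2, -2 * u 1 * u 2, -exp (-2 * p 2) * u 0 ^ 2 + exp (2 * p 2) * u 1 ^ 2]

lemma christoffel_contraction (p u : R3) :
    (fun k => -∑ i, ∑ j, christoffel k i j p * u i * u j) = geodesicAccel p u := by
  have hm : ∀ i j : Fin 3, (fun q : R3 => metric q i j) =
      if i = j then ![fun q : R3 => exp (-2 * q 2), fun q => exp (2 * q 2), fun _ => 1] i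
      else fun _ => 0 := by
    intro i j
    funext q
    fin_cases i <;> fin_cases j <;> simp [metric]
  have e : exp (2 * p 2) * exp (-2 * p 2) = 1 := by rw [← exp_add]; simp
  funext k
  simp only [christoffel, hm, metric_inv, geodesicAccel]
  fin_cases k <;> simp [Fin.sum_univ_three, partialDeriv_const, partialDeriv_exp, -neg_mul]
  · linear_combination 2 * u 0 * u 2 * e
  · linear_combination -2 * u 1 * u 2 * e
  · ring

lemma isGeodesic_iff {γ : ℝ → R3} :
    IsGeodesic γ ↔
      Differentiable ℝ γ ∧ ∀ t, HasDerivAt (deriv γ) (geodesicAccel (γ t) (deriv γ t)) t := by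
  simp only [IsGeodesic, christoffel_contraction]

lemma contDiff_geodesicSpray :
    ContDiff ℝ 1 (fun s : R3 × R3 => (s.2, geodesicAccel s.1 s.2)) := by
  refine contDiff_snd.prodMk (contDiff_pi.2 fun k => ?_)
  fin_cases k <;> simp only [geodesicAccel] <;> simp <;> fun_prop

/-- A geodesic is determined by its initial position and velocity. -/
lemma IsGeodesic.apply_one_eq {γ η : ℝ → R3} (hγ : IsGeodesic γ) (hη : IsGeodesic η)
    (h0 : γ 0 = η 0) (h1 : deriv γ 0 = deriv η 0) : γ 1 = η 1 := by
  rw [isGeodesic_iff] at hγ hη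
  have key : ∀ {c : ℝ → R3}, (Differentiable ℝ c ∧
      ∀ t, HasDerivAt (deriv c) (geodesicAccel (c t) (deriv c t)) t) →
      ∀ t, HasDerivAt (fun t => (c t, deriv c t)) (deriv c t, geodesicAccel (c t) (deriv c t)) t :=
    fun hc t => (hc.1 t).hasDerivAt.prodMk (hc.2 t)
  have cont : ∀ {c : ℝ → R3}, (Differentiable ℝ c ∧
      ∀ t, HasDerivAt (deriv c) (geodesicAccel (c t) (deriv c t)) t) →
      Continuous fun t => (c t, deriv c t) :=
    fun hc => continuous_iff_continuousAt.2 fun t => (key hc t).continuousAt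
  -- the spray is only locally Lipschitz, hence Lipschitz on the compact union of the two orbits
  obtain ⟨K, hK⟩ := (contDiff_geodesicSpray.locallyLipschitz.locallyLipschitzOn
    (s := (fun t => (γ t, deriv γ t)) '' Icc 0 1 ∪
      (fun t => (η t, deriv η t)) '' Icc 0 1)).exists_lipschitzOnWith_of_compact
    ((isCompact_Icc.image (cont hγ)).union (isCompact_Icc.image (cont hη)))
  have := ODE_solution_unique_of_mem_Icc_right (v := fun _ => _) (s := fun _ => _)
    (fun _ _ => hK) (cont hγ).continuousOn (fun t _ => (key hγ t).hasDerivWithinAt)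
    (fun t ht => Or.inl ⟨t, Ico_subset_Icc_self ht, rfl⟩)
    (cont hη).continuousOn (fun t _ => (key hη t).hasDerivWithinAt)
    (fun t ht => Or.inr ⟨t, Ico_subset_Icc_self ht, rfl⟩) (by simp [h0, h1])
    (right_mem_Icc.2 zero_le_one)
  exact congrArg Prod.fst this

lemma IsGeodesic.expMap_eq {γ : ℝ → R3} (hγ : IsGeodesic γ) (h0 : γ 0 = 0) :
    expMap (deriv γ 0) = γ 1 := by
  have h : ∃ η : ℝ → R3, IsGeodesic η ∧ η 0 = 0 ∧ deriv η 0 = deriv γ 0 := ⟨γ, hγ, h0, rfl⟩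
  rw [expMap, dif_pos h]
  obtain ⟨h1, h2, h3⟩ := h.choose_spec
  exact h1.apply_one_eq hγ (h2.trans h0.symm) h3

/-! ### The horizontal geodesics in closed form -/

/-- `√(u² cos² θ + v² sin² θ)`, the speed of the parametrization `θ ↦ (u sin θ, v cos θ)` of the
ellipse with semi-axes `|u|` and `|v|`. -/
noncomputable def ellipseSpeed (u v θ : ℝ) : ℝ :=
  √(u ^ 2 * cos θ ^ 2 + v ^ 2 * sin θ ^ 2)

/-- Half the perimeter of the ellipse with semi-axes `|u|` and `|v|`. -/
noncomputable def halfPerimeter (u v : ℝ) : ℝ :=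
  ∫ θ in 0..π, ellipseSpeed u v θ

lemma sq_ellipseSpeed (u v θ : ℝ) :
    ellipseSpeed u v θ ^ 2 = u ^ 2 * cos θ ^ 2 + v ^ 2 * sin θ ^ 2 :=
  sq_sqrt (by positivity)

lemma ellipseSpeed_pos {u v : ℝ} (hu : u ≠ 0) (hv : v ≠ 0) (θ : ℝ) : 0 < ellipseSpeed u v θ := by
  refine sqrt_pos.2 ?_
  have h := cos_sq_add_sin_sq θ
  rcases eq_or_ne (sin θ) 0 with hs | hs
  · have hc : cos θ ^ 2 = 1 := by simpa [hs] using h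
    rw [hc]; positivity
  · positivity

@[fun_prop]
lemma continuous_ellipseSpeed (u v : ℝ) : Continuous (ellipseSpeed u v) := by
  unfold ellipseSpeed; fun_prop

lemma hasDerivAt_ellipseSpeed {u v : ℝ} (hu : u ≠ 0) (hv : v ≠ 0) (θ : ℝ) :
    HasDerivAt (ellipseSpeed u v)
      ((v ^ 2 - u ^ 2) * (sin θ * cos θ) / ellipseSpeed u v θ) θ := by
  have h0 := ellipseSpeed_pos hu hv θ
  have h := ((((hasDerivAt_cos θ).pow 2).const_mul (u ^ 2)).add
    (((hasDerivAt_sin θ).pow 2).const_mul (v ^ 2))).sqrt (sqrt_pos.1 h0).ne'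
  convert! h using 1
  change _ = _ / (2 * ellipseSpeed u v θ)
  field_simp
  simp
  ring

/-- An autonomous scalar equation `φ' = v(φ)` with `v` positive and bounded is solved for all times
by inverting `∫ 1 / v`, the time needed to reach a given position. -/
lemma exists_solution_of_pos_of_le {v : ℝ → ℝ} (hv : Continuous v) (h0 : ∀ θ, 0 < v θ) {M : ℝ}
    (hM : ∀ θ, v θ ≤ M) :
    ∃ φ : ℝ → ℝ, (∀ t, HasDerivAt φ (v (φ t)) t) ∧ ∀ c, φ (∫ θ in 0..c, (v θ)⁻¹) = c := by
  have hM0 : 0 < M := (h0 0).trans_le (hM 0)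
  set F : ℝ → ℝ := fun c => ∫ θ in 0..c, (v θ)⁻¹ with hF
  have hd : ∀ c, HasDerivAt F (v c)⁻¹ c := fun c =>
    (hv.inv₀ fun θ => (h0 θ).ne').integral_hasStrictDerivAt 0 c |>.hasDerivAt
  have hmono : StrictMono F := strictMono_of_deriv_pos fun c => by
    rw [(hd c).deriv]; exact inv_pos.2 (h0 c)
  have hdiff : Differentiable ℝ F := fun c => (hd c).differentiableAt
  have hF0 : F 0 = 0 := by simp [hF]
  have hge := mul_sub_le_image_sub_of_le_deriv hdiff (C := M⁻¹) fun c => by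
    rw [(hd c).deriv]; exact inv_anti₀ (h0 c) (hM c)
  have hM' : 0 < M⁻¹ := inv_pos.2 hM0
  have htop : Tendsto F atTop atTop := by
    refine tendsto_atTop_mono' _ ?_ (tendsto_id.const_mul_atTop hM')
    filter_upwards [eventually_ge_atTop 0] with c hc
    simpa [hF0] using hge hc
  have hbot : Tendsto F atBot atBot := by
    refine tendsto_atBot_mono' _ ?_ (tendsto_id.const_mul_atBot hM')
    filter_upwards [eventually_le_atBot 0] with c hc
    have := hge hc
    simp only [hF0, id] at this ⊢
    linarith
  let e := hmono.orderIsoOfSurjective F (hdiff.continuous.surjective htop hbot)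
  have he : ∀ c, e c = F c := fun c => rfl
  refine ⟨e.symm, fun t => ?_, fun c => e.symm_apply_apply c⟩
  have := HasDerivAt.of_local_left_inverse (f := F) (g := e.symm) (a := t)
    e.symm.continuous.continuousAt (hd _) (inv_pos.2 (h0 _)).ne'
    (.of_forall fun y => e.apply_symm_apply y)
  simpa using this

/-- The geodesic with initial velocity `(X, Y, 0)`. In the frame of left invariant fields its
velocity is `(X e^Z, Y e^{-Z}, Z')`, where `Z` is the height, and `|X| e^Z = ellipseSpeed X Y φ`
for the phase `φ` which starts at `0` and moves with speed `φ' = ellipseSpeed X Y φ`. When `φ`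
reaches `π`, the height is `0` again. -/
lemma expMap_horizontal {X Y : ℝ} (hX : X ≠ 0) (hY : Y ≠ 0)
    (hT : ∫ θ in 0..π, (ellipseSpeed X Y θ)⁻¹ = 1) :
    expMap ![X, Y, 0] = ![halfPerimeter X Y / X, halfPerimeter X Y / Y, 0] := by
  have hpos := ellipseSpeed_pos hX hY
  obtain ⟨φ, hφ, hφF⟩ := exists_solution_of_pos_of_le (continuous_ellipseSpeed X Y) hpos
    (M := √(X ^ 2 + Y ^ 2)) fun θ => sqrt_le_sqrt (by
      nlinarith [cos_sq_add_sin_sq θ, mul_nonneg (sq_nonneg X) (sq_nonneg (sin θ)),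
        mul_nonneg (sq_nonneg Y) (sq_nonneg (cos θ))])
  have hφ0 : φ 0 = 0 := by simpa using hφF 0
  have hφ1 : φ 1 = π := by simpa [hT] using hφF π
  set D := ellipseSpeed X Y with hD
  set P : ℝ → ℝ := fun c => ∫ θ in 0..c, D θ with hPdef
  have hP : ∀ c, HasDerivAt P (D c) c := fun c =>
    ((continuous_ellipseSpeed X Y).integral_hasStrictDerivAt 0 c).hasDerivAt
  set W : ℝ → ℝ := fun θ => (Y ^ 2 - X ^ 2) * (sin θ * cos θ) / D θ with hWdef
  have hDd : ∀ θ, HasDerivAt D (W θ) θ := hasDerivAt_ellipseSpeed hX hY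
  have hDsq : ∀ θ, D θ ^ 2 = X ^ 2 * cos θ ^ 2 + Y ^ 2 * sin θ ^ 2 := sq_ellipseSpeed X Y
  have hWd : ∀ θ, HasDerivAt W ((X ^ 2 * Y ^ 2 / D θ ^ 2 - D θ ^ 2) / D θ) θ := fun θ => by
    have h := ((((hasDerivAt_sin θ).mul (hasDerivAt_cos θ)).const_mul (Y ^ 2 - X ^ 2)).div
      (hDd θ) (hpos θ).ne')
    convert! h using 1
    have := (hpos θ).ne'
    simp only [hWdef, Pi.mul_apply]
    field_simp
    rw [show D θ ^ 4 = (D θ ^ 2) ^ 2 by ring, hDsq]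
    linear_combination
      -X ^ 2 * Y ^ 2 * (cos θ ^ 2 + sin θ ^ 2 + 1) * cos_sq_add_sin_sq θ
  have hexp : ∀ t, exp (2 * (log (D (φ t) ^ 2 / X ^ 2) / 2)) = D (φ t) ^ 2 / X ^ 2 := fun t => by
    rw [mul_div_cancel₀ _ two_ne_zero, exp_log (by have := hpos (φ t); positivity)]
  set γ : ℝ → R3 := fun t =>
    ![P (φ t) / X, (P (φ t) + W (φ t)) / Y, log (D (φ t) ^ 2 / X ^ 2) / 2] with hγ
  set u : ℝ → R3 := fun t =>
    ![D (φ t) ^ 2 / X, X ^ 2 * Y / D (φ t) ^ 2, W (φ t)] with hu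
  have hγd : ∀ t, HasDerivAt γ (u t) t := fun t => by
    have := (hpos (φ t)).ne'
    have h1 := (hP _).comp t (hφ t)
    have h2 := (hWd _).comp t (hφ t)
    have h3 := ((((hDd _).comp t (hφ t)).pow 2).div_const (X ^ 2)).log
      (by simp; exact ⟨this, hX⟩)
    rw [hasDerivAt_pi]
    intro k
    fin_cases k
    · refine (h1.div_const X).congr_deriv ?_
      simp [hu]; field_simp
    · refine ((h1.add h2).div_const Y).congr_deriv ?_
      simp [hu]; field_simp; ring
    · refine (h3.div_const 2).congr_deriv ?_
      simp [hu]; field_simp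
  have hderiv : deriv γ = u := funext fun t => (hγd t).deriv
  have hgeo : IsGeodesic γ := by
    refine isGeodesic_iff.2 ⟨fun t => (hγd t).differentiableAt, fun t => ?_⟩
    rw [hderiv, hasDerivAt_pi]
    have := (hpos (φ t)).ne'
    have h1 := ((hDd _).comp t (hφ t)).pow 2
    have h2 := (hWd _).comp t (hφ t)
    intro k
    fin_cases k
    · refine (h1.div_const X).congr_deriv ?_
      simp [hu, geodesicAccel]; field_simp
    · refine ((hasDerivAt_const t (X ^ 2 * Y)).div h1 (by simpa using this)).congr_deriv ?_
      simp [hu, geodesicAccel]; field_simp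
    · refine h2.congr_deriv ?_
      have e2 : exp (-2 * γ t 2) = X ^ 2 / D (φ t) ^ 2 := by
        rw [neg_mul, exp_neg, show γ t 2 = log (D (φ t) ^ 2 / X ^ 2) / 2 from rfl, hexp, inv_div]
      simp only [geodesicAccel, e2]
      simp [hu]
      rw [show γ t 2 = log (D (φ t) ^ 2 / X ^ 2) / 2 from rfl, hexp]
      field_simp
      ring
  have hD0 : D 0 ^ 2 = X ^ 2 := by simp [hDsq]
  have hDπ : D π ^ 2 = X ^ 2 := by simp [hDsq]
  have hX2 : X ^ 2 ≠ 0 := pow_ne_zero 2 hX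
  have h0 : γ 0 = 0 := by
    funext k
    fin_cases k <;> simp [hγ, hφ0, hD0, hPdef, hWdef, hX2]
  have hu0 : deriv γ 0 = ![X, Y, 0] := by
    rw [hderiv]
    funext k
    fin_cases k <;> simp [hu, hφ0, hD0, hWdef] <;> field_simp
  rw [← hu0, hgeo.expMap_eq h0]
  funext k
  fin_cases k <;> simp [hγ, hφ1, hDπ, hWdef, hX2] <;> rfl

/-! ### Gauss's formula for the arithmetic-geometric mean -/

/-- `∫₀^π dθ / √(u² cos² θ + v² sin² θ)`, twice the complete elliptic integral which Gauss's formula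
evaluates. -/
noncomputable def ellipticPeriod (u v : ℝ) : ℝ :=
  ∫ θ in 0..π, (ellipseSpeed u v θ)⁻¹

lemma periodic_ellipseSpeed (u v : ℝ) : Function.Periodic (ellipseSpeed u v) π := fun θ => by
  simp [ellipseSpeed, cos_add_pi, sin_add_pi]

/-- Landen's substitution `ψ`, determined by `tan (ψ - θ) = (b / a) tan θ`. This way to write it is
smooth for all `θ`. -/
noncomputable def landen (a b θ : ℝ) : ℝ :=
  2 * θ + arctan ((b - a) * (sin θ * cos θ) / (a * cos θ ^ 2 + b * sin θ ^ 2))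

section Landen

variable {a b : ℝ}

lemma landen_denom_pos (ha : 0 < a) (hb : 0 < b) (θ : ℝ) :
    0 < a * cos θ ^ 2 + b * sin θ ^ 2 := by
  have h := cos_sq_add_sin_sq θ
  rcases eq_or_ne (sin θ) 0 with hs | hs
  · have hc : cos θ ^ 2 = 1 := by simpa [hs] using h
    rw [hc]; positivity
  · positivity

lemma one_add_landen_sq (ha : 0 < a) (hb : 0 < b) (θ : ℝ) :
    1 + ((b - a) * (sin θ * cos θ) / (a * cos θ ^ 2 + b * sin θ ^ 2)) ^ 2 =
      ellipseSpeed a b θ ^ 2 / (a * cos θ ^ 2 + b * sin θ ^ 2) ^ 2 := by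
  have h := (landen_denom_pos ha hb θ).ne'
  rw [sq_ellipseSpeed]
  field_simp
  simp only [cos_sq' θ]
  ring

lemma hasDerivAt_landen (ha : 0 < a) (hb : 0 < b) (θ : ℝ) :
    HasDerivAt (landen a b)
      ((a + b) * (a * cos θ ^ 2 + b * sin θ ^ 2) / ellipseSpeed a b θ ^ 2) θ := by
  have hN := (landen_denom_pos ha hb θ).ne'
  have hD := (ellipseSpeed_pos ha.ne' hb.ne' θ).ne'
  have h := ((hasDerivAt_id θ).const_mul 2).add
    (((((hasDerivAt_sin θ).mul (hasDerivAt_cos θ)).const_mul (b - a)).div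
      ((((hasDerivAt_cos θ).pow 2).const_mul a).add
        (((hasDerivAt_sin θ).pow 2).const_mul b)) hN).arctan)
  refine h.congr_deriv ?_
  have e := one_add_landen_sq ha hb θ
  simp only [Pi.mul_apply, Pi.add_apply, Pi.pow_apply, Pi.div_apply] at e ⊢
  rw [e]
  field_simp
  simp only [sq_ellipseSpeed]
  simp
  linear_combination ((a + b) * (a * cos θ ^ 2 + b * sin θ ^ 2) -
    2 * (a ^ 2 * cos θ ^ 2 + b ^ 2 * sin θ ^ 2)) * cos_sq_add_sin_sq θ

lemma cos_landen (ha : 0 < a) (hb : 0 < b) (θ : ℝ) :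
    cos (landen a b θ) = (a * cos θ ^ 2 - b * sin θ ^ 2) / ellipseSpeed a b θ := by
  have hN := landen_denom_pos ha hb θ
  have hD := ellipseSpeed_pos ha.ne' hb.ne' θ
  rw [landen, cos_add, sin_arctan, cos_arctan, one_add_landen_sq ha hb, sqrt_div' _ (by positivity),
    sqrt_sq hD.le, sqrt_sq hN.le, cos_two_mul', sin_two_mul]
  generalize hNd : a * cos θ ^ 2 + b * sin θ ^ 2 = N at hN ⊢
  field_simp
  rw [← hNd]
  linear_combination (a * cos θ ^ 2 - b * sin θ ^ 2) * cos_sq_add_sin_sq θ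

lemma sin_landen (ha : 0 < a) (hb : 0 < b) (θ : ℝ) :
    sin (landen a b θ) = (a + b) * (sin θ * cos θ) / ellipseSpeed a b θ := by
  have hN := landen_denom_pos ha hb θ
  have hD := ellipseSpeed_pos ha.ne' hb.ne' θ
  rw [landen, sin_add, sin_arctan, cos_arctan, one_add_landen_sq ha hb, sqrt_div' _ (by positivity),
    sqrt_sq hD.le, sqrt_sq hN.le, cos_two_mul', sin_two_mul]
  generalize hNd : a * cos θ ^ 2 + b * sin θ ^ 2 = N at hN ⊢
  field_simp
  rw [← hNd]
  linear_combination (a + b) * sin θ * cos θ * cos_sq_add_sin_sq θ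

lemma ellipseSpeed_landen (ha : 0 < a) (hb : 0 < b) (θ : ℝ) :
    ellipseSpeed ((a + b) / 2) √(a * b) (landen a b θ) =
      (a + b) * (a * cos θ ^ 2 + b * sin θ ^ 2) / (2 * ellipseSpeed a b θ) := by
  have hN := landen_denom_pos ha hb θ
  have hD := ellipseSpeed_pos ha.ne' hb.ne' θ
  refine (sq_eq_sq₀ (sqrt_nonneg _) (by positivity)).1 ?_
  change ellipseSpeed _ _ _ ^ 2 = _
  rw [sq_ellipseSpeed, sq_sqrt (by positivity), cos_landen ha hb, sin_landen ha hb]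
  field_simp
  ring

/-- Gauss's invariance: the period does not change when its arguments are replaced by their
arithmetic and geometric means. -/
lemma ellipticPeriod_means (ha : 0 < a) (hb : 0 < b) :
    ellipticPeriod ((a + b) / 2) √(a * b) = ellipticPeriod a b := by
  set g : ℝ → ℝ := fun ψ => (ellipseSpeed ((a + b) / 2) √(a * b) ψ)⁻¹ with hg
  have hgc : Continuous g := (continuous_ellipseSpeed _ _).inv₀ fun θ =>
    (ellipseSpeed_pos (by positivity) (by positivity) θ).ne'
  have hgp : Function.Periodic g π := fun θ => by
    simp only [hg, periodic_ellipseSpeed _ _ θ]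
  have hN := landen_denom_pos ha hb
  have hD := ellipseSpeed_pos ha.ne' hb.ne'
  have hsub := intervalIntegral.integral_comp_mul_deriv (a := 0) (b := π)
    (fun θ _ => hasDerivAt_landen ha hb θ) (by
      refine Continuous.continuousOn ?_
      refine Continuous.div (by fun_prop) (by fun_prop) fun θ => (pow_pos (hD θ) 2).ne') hgc
  have h0 : landen a b 0 = 0 := by simp [landen]
  have hπ : landen a b π = π + π := by simp [landen]; ring
  have hleft : ∀ θ, (g ∘ landen a b) θ *
      ((a + b) * (a * cos θ ^ 2 + b * sin θ ^ 2) / ellipseSpeed a b θ ^ 2) =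
      2 * (ellipseSpeed a b θ)⁻¹ := fun θ => by
    have := (hN θ).ne'
    have := (hD θ).ne'
    have : a + b ≠ 0 := by positivity
    simp only [hg, Function.comp, ellipseSpeed_landen ha hb]
    field_simp
  have hright : ∫ ψ in 0..(π + π), g ψ = 2 * ∫ ψ in 0..π, g ψ := by
    have h := hgp.intervalIntegral_add_eq π 0
    rw [← intervalIntegral.integral_add_adjacent_intervals
      (hgc.intervalIntegrable 0 π) (hgc.intervalIntegrable _ _), h, zero_add]
    ring
  simp only [hleft, h0, hπ, intervalIntegral.integral_const_mul, hright] at hsub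
  simp only [ellipticPeriod]
  linarith

lemma ellipticPeriod_comm (u v : ℝ) : ellipticPeriod u v = ellipticPeriod v u := by
  have hp : Function.Periodic (fun θ => (ellipseSpeed u v θ)⁻¹) π := fun θ => by
    simp only [periodic_ellipseSpeed _ _ θ]
  have h := hp.intervalIntegral_add_eq 0 (-(π / 2))
  have hs : ∀ θ, ellipseSpeed v u θ = ellipseSpeed u v (π / 2 - θ) := fun θ => by
    rw [ellipseSpeed, ellipseSpeed, cos_pi_div_two_sub, sin_pi_div_two_sub, add_comm]
  simp only [ellipticPeriod, hs]
  rw [intervalIntegral.integral_comp_sub_left (fun θ => (ellipseSpeed u v θ)⁻¹)]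
  rw [zero_add] at h
  rw [h]
  congr 1 <;> ring

end Landen

lemma le_ellipticPeriod {u v M : ℝ} (hu : 0 < u) (hv : 0 < v) (huM : u ≤ M) (hvM : v ≤ M) :
    π / M ≤ ellipticPeriod u v := by
  have h : ∫ _ in 0..π, M⁻¹ ≤ ellipticPeriod u v := by
    refine intervalIntegral.integral_mono_on pi_pos.le (by simp)
      (((continuous_ellipseSpeed u v).inv₀ fun θ =>
        (ellipseSpeed_pos hu.ne' hv.ne' θ).ne').intervalIntegrable _ _) fun θ _ => ?_
    refine inv_anti₀ (ellipseSpeed_pos hu.ne' hv.ne' θ) (sqrt_le_iff.2 ⟨by linarith, ?_⟩)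
    calc u ^ 2 * cos θ ^ 2 + v ^ 2 * sin θ ^ 2 ≤ M ^ 2 * cos θ ^ 2 + M ^ 2 * sin θ ^ 2 := by gcongr
      _ = M ^ 2 := by rw [← mul_add, cos_sq_add_sin_sq, mul_one]
  simpa [div_eq_mul_inv] using h

lemma ellipticPeriod_le {u v m : ℝ} (hm : 0 < m) (hu : m ≤ u) (hv : m ≤ v) :
    ellipticPeriod u v ≤ π / m := by
  have h : ellipticPeriod u v ≤ ∫ _ in 0..π, m⁻¹ := by
    refine intervalIntegral.integral_mono_on pi_pos.le
      (((continuous_ellipseSpeed u v).inv₀ fun θ =>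
        (ellipseSpeed_pos (hm.trans_le hu).ne' (hm.trans_le hv).ne' θ).ne').intervalIntegrable _ _)
      (by simp) fun θ _ => ?_
    refine inv_anti₀ hm (le_sqrt_of_sq_le ?_)
    calc m ^ 2 = m ^ 2 * cos θ ^ 2 + m ^ 2 * sin θ ^ 2 := by
          rw [← mul_add, cos_sq_add_sin_sq, mul_one]
      _ ≤ u ^ 2 * cos θ ^ 2 + v ^ 2 * sin θ ^ 2 := by gcongr
  simpa [div_eq_mul_inv] using h

open NNReal in
lemma ellipticPeriod_agmSequences {x y : ℝ≥0} (hx : 0 < x) (hy : 0 < y) (n : ℕ) :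
    ellipticPeriod (agmSequences x y n).1 (agmSequences x y n).2 = ellipticPeriod x y := by
  induction n generalizing x y with
  | zero =>
    rw [agmSequences_zero, ellipticPeriod_comm, ← ellipticPeriod_means (a := x) (b := y) hx hy]
    simp
  | succ n ih =>
    rw [agmSequences_succ, ih (NNReal.sqrt_pos.2 (mul_pos hx hy)) (by positivity), ellipticPeriod_comm,
      ← ellipticPeriod_means (a := x) (b := y) hx hy]
    simp

open NNReal in
/-- Gauss's formula. -/
lemma ellipticPeriod_eq_pi_div_agm {x y : ℝ≥0} (hx : 0 < x) (hy : 0 < y) :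
    ellipticPeriod x y = π / agm x y := by
  have hpos : (0 : ℝ) < agm x y := agm_pos hx hy
  have h0 : (0 : ℝ) < (agmSequences x y 0).1 := by
    simp only [agmSequences_zero]; exact_mod_cast NNReal.sqrt_pos.2 (mul_pos hx hy)
  have hlow : ∀ n, (0 : ℝ) < (agmSequences x y n).1 := fun n =>
    h0.trans_le (by exact_mod_cast agmSequences_fst_monotone (Nat.zero_le n))
  have hle : ∀ n, ((agmSequences x y n).1 : ℝ) ≤ (agmSequences x y n).2 := fun n => by
    exact_mod_cast agmSequences_fst_le_snd n n
  have h1 : Tendsto (fun n => ((agmSequences x y n).1 : ℝ)) atTop (𝓝 (agm x y)) :=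
    NNReal.tendsto_coe.2 tendsto_agmSequences_fst_agm
  have h2 : Tendsto (fun n => ((agmSequences x y n).2 : ℝ)) atTop (𝓝 (agm x y)) :=
    NNReal.tendsto_coe.2 tendsto_agmSequences_snd_agm
  refine le_antisymm ?_ ?_
  · refine ge_of_tendsto' (tendsto_const_nhds.div h1 hpos.ne') fun n => ?_
    rw [← ellipticPeriod_agmSequences hx hy n]
    exact ellipticPeriod_le (hlow n) le_rfl (hle n)
  · refine le_of_tendsto' (tendsto_const_nhds.div h2 hpos.ne') fun n => ?_
    rw [← ellipticPeriod_agmSequences hx hy n]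
    exact le_ellipticPeriod (hlow n) ((hlow n).trans_le (hle n)) (hle n) le_rfl

lemma mu_horizontal (X Y : ℝ) :
    mu ![X, Y, 0] = NNReal.agm (toNNReal |X|) (toNNReal |Y|) := by
  rw [NNReal.agm_eq_agm_gm_am, mu]
  congr 2
  · ext
    simp [abs_mul, mul_nonneg]
  · ext
    simp [abs_of_nonneg (add_nonneg (abs_nonneg X) (abs_nonneg Y)), sqrt_sq_eq_abs]
    rw [max_eq_left (by positivity)]
    ring

/-- A horizontal vector is perfect exactly if its period is `1`. -/
lemma mu_horizontal_eq_pi_iff {X Y : ℝ} :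
    mu ![X, Y, 0] = π ↔ X ≠ 0 ∧ Y ≠ 0 ∧ ellipticPeriod X Y = 1 := by
  rw [mu_horizontal]
  rcases eq_or_ne X 0 with rfl | hX
  · simp [pi_pos.ne]
  rcases eq_or_ne Y 0 with rfl | hY
  · simp [pi_pos.ne]
  have hX' : 0 < toNNReal |X| := toNNReal_pos.2 (abs_pos.2 hX)
  have hY' : 0 < toNNReal |Y| := toNNReal_pos.2 (abs_pos.2 hY)
  have hpos : (0 : ℝ) < NNReal.agm (toNNReal |X|) (toNNReal |Y|) := NNReal.agm_pos hX' hY'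
  have h := ellipticPeriod_eq_pi_div_agm hX' hY'
  have habs : ellipticPeriod (toNNReal |X|) (toNNReal |Y|) = ellipticPeriod X Y := by
    simp [ellipticPeriod, ellipseSpeed]
  rw [← habs, h, div_eq_one_iff_eq hpos.ne']
  simp [hX, hY, eq_comm]

/-! ### Half perimeters of ellipses -/

lemma ellipseSpeed_mul (k u v θ : ℝ) :
    ellipseSpeed (k * u) (k * v) θ = |k| * ellipseSpeed u v θ := by
  rw [ellipseSpeed, ellipseSpeed, ← sqrt_sq_eq_abs, ← sqrt_mul (sq_nonneg k)]
  congr 1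
  ring

lemma halfPerimeter_mul (k u v : ℝ) :
    halfPerimeter (k * u) (k * v) = |k| * halfPerimeter u v := by
  simp [halfPerimeter, ellipseSpeed_mul]

lemma ellipticPeriod_mul (k u v : ℝ) :
    ellipticPeriod (k * u) (k * v) = |k|⁻¹ * ellipticPeriod u v := by
  simp [ellipticPeriod, ellipseSpeed_mul, mul_comm]

lemma ellipticPeriod_pos {u v : ℝ} (hu : u ≠ 0) (hv : v ≠ 0) : 0 < ellipticPeriod u v :=
  intervalIntegral.intervalIntegral_pos_of_pos
    (((continuous_ellipseSpeed u v).inv₀ fun θ =>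
      (ellipseSpeed_pos hu hv θ).ne').intervalIntegrable _ _)
    (fun θ => inv_pos.2 (ellipseSpeed_pos hu hv θ)) pi_pos

@[fun_prop]
lemma continuous_halfPerimeter : Continuous fun p : ℝ × ℝ => halfPerimeter p.1 p.2 := by
  unfold halfPerimeter ellipseSpeed
  refine intervalIntegral.continuous_parametric_intervalIntegral_of_continuous' ?_ 0 π
  simp only [Function.uncurry_def]
  fun_prop

lemma abs_fst_le_halfPerimeter (u v : ℝ) : |u| * (π / 2) ≤ halfPerimeter u v := by
  have h : ∫ θ in 0..π, |u| * cos θ ^ 2 ≤ halfPerimeter u v := by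
    refine intervalIntegral.integral_mono_on pi_pos.le
      ((by fun_prop : Continuous fun θ => |u| * cos θ ^ 2).intervalIntegrable _ _)
      ((continuous_ellipseSpeed u v).intervalIntegrable _ _) fun θ _ => le_sqrt_of_sq_le ?_
    have h1 := cos_sq_le_one θ
    have h2 : (cos θ ^ 2) ^ 2 ≤ cos θ ^ 2 := by nlinarith [sq_nonneg (cos θ)]
    rw [mul_pow, sq_abs]
    have := mul_le_mul_of_nonneg_left h2 (sq_nonneg u)
    have := mul_nonneg (sq_nonneg v) (sq_nonneg (sin θ))
    linarith
  simpa [integral_cos_sq] using h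

lemma abs_snd_le_halfPerimeter (u v : ℝ) : |v| * (π / 2) ≤ halfPerimeter u v := by
  have h : ∫ θ in 0..π, |v| * sin θ ^ 2 ≤ halfPerimeter u v := by
    refine intervalIntegral.integral_mono_on pi_pos.le
      ((by fun_prop : Continuous fun θ => |v| * sin θ ^ 2).intervalIntegrable _ _)
      ((continuous_ellipseSpeed u v).intervalIntegrable _ _) fun θ _ => le_sqrt_of_sq_le ?_
    have h1 := sin_sq_le_one θ
    have h2 : (sin θ ^ 2) ^ 2 ≤ sin θ ^ 2 := by nlinarith [sq_nonneg (sin θ)]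
    rw [mul_pow, sq_abs]
    have := mul_le_mul_of_nonneg_left h2 (sq_nonneg v)
    have := mul_nonneg (sq_nonneg u) (sq_nonneg (cos θ))
    linarith
  simpa [integral_sin_sq] using h

lemma halfPerimeter_lt {u v w : ℝ} (hv : 0 ≤ v) (hvw : v < w) :
    halfPerimeter u v < halfPerimeter u w := by
  have hsq : v ^ 2 < w ^ 2 := by gcongr
  refine intervalIntegral.integral_lt_integral_of_continuousOn_of_le_of_exists_lt pi_pos
    (continuous_ellipseSpeed _ _).continuousOn (continuous_ellipseSpeed _ _).continuousOn
    (fun θ _ => ?_) ⟨π / 2, ⟨by positivity, by linarith [pi_pos]⟩, ?_⟩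
  · exact sqrt_le_sqrt (by gcongr)
  · simpa [ellipseSpeed] using sqrt_lt_sqrt (sq_nonneg v) hsq

/-! ### The curves and the region beyond them -/

/-- The reciprocity `E(X, Y, 0) = (S / X, S / Y, 0)` and the homogeneity of `halfPerimeter` eliminate
the initial velocity: the image curve has an equation in the coordinates of the endpoint. -/
lemma mem_bdry₀N_iff {p : R3} :
    p ∈ bdry₀N ↔ p 2 = 0 ∧ p 0 ≠ 0 ∧ p 1 ≠ 0 ∧ halfPerimeter (p 1) (p 0) = |p 0 * p 1| := by
  constructor
  · rintro ⟨V, ⟨hV, hz⟩, rfl⟩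
    have hVe : V = ![V 0, V 1, 0] := by
      funext k
      fin_cases k <;> simp
      exact hz
    generalize V 0 = X, V 1 = Y at hVe
    subst hVe
    obtain ⟨hX, hY, hT⟩ := mu_horizontal_eq_pi_iff.1 hV
    rw [expMap_horizontal hX hY hT]
    have hS : 0 < halfPerimeter X Y :=
      (by positivity : 0 < |X| * (π / 2)).trans_le (abs_fst_le_halfPerimeter X Y)
    refine ⟨rfl, div_ne_zero hS.ne' hX, div_ne_zero hS.ne' hY, ?_⟩
    set S := halfPerimeter X Y with hSdef
    change halfPerimeter (S / Y) (S / X) = |S / X * (S / Y)|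
    have h := halfPerimeter_mul (S / (X * Y)) X Y
    rw [show S / (X * Y) * X = S / Y by field_simp, show S / (X * Y) * Y = S / X by field_simp,
      ← hSdef] at h
    rw [h, show S / X * (S / Y) = S / (X * Y) * S by field_simp, abs_mul, abs_of_pos hS]
  · rintro ⟨hz, h0, h1, hH⟩
    have hT := ellipticPeriod_pos h1 h0
    set T := ellipticPeriod (p 1) (p 0) with hTdef
    -- the sign of `p 0 * p 1` makes the velocity point into the quadrant of `p`
    set c := T * (|p 0 * p 1| / (p 0 * p 1)) with hc
    have h01 : p 0 * p 1 ≠ 0 := mul_ne_zero h0 h1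
    have hcabs : |c| = T := by
      rw [hc, abs_mul, abs_of_pos hT, abs_div, abs_abs, div_self (abs_ne_zero.2 h01), mul_one]
    have hc0 : c ≠ 0 := by rw [← abs_ne_zero, hcabs]; exact hT.ne'
    have hper : ellipticPeriod (c * p 1) (c * p 0) = 1 := by
      rw [ellipticPeriod_mul, hcabs, inv_mul_cancel₀ hT.ne']
    have hX := mul_ne_zero hc0 h1
    have hY := mul_ne_zero hc0 h0
    refine ⟨![c * p 1, c * p 0, 0], ⟨mu_horizontal_eq_pi_iff.2 ⟨hX, hY, hper⟩, rfl⟩, ?_⟩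
    have habs : |p 0 * p 1| ≠ 0 := abs_ne_zero.2 h01
    rw [expMap_horizontal hX hY hper, halfPerimeter_mul, hcabs, hH, hc]
    have := hT.ne'
    funext k
    fin_cases k
    · simp; field_simp
    · simp; field_simp
    · exact hz.symm

/-- The function on the plane `z = 0` which vanishes on `bdry₀N` and is positive beyond it. -/
noncomputable def excess (p : R3) : ℝ :=
  |p 0 * p 1| - halfPerimeter (p 1) (p 0)

lemma continuous_excess : Continuous excess := by
  unfold excess
  exact (by fun_prop : Continuous fun p : R3 => |p 0 * p 1|).sub
    (continuous_halfPerimeter.comp (by fun_prop : Continuous fun p : R3 => (p 1, p 0)))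

lemma excess_smul {s : ℝ} (hs : 0 ≤ s) (p : R3) :
    excess (s • p) = s * excess p + s * (s - 1) * |p 0 * p 1| := by
  have : s * p 0 * (s * p 1) = s ^ 2 * (p 0 * p 1) := by ring
  simp only [excess, Pi.smul_apply, smul_eq_mul, halfPerimeter_mul, abs_of_nonneg hs, this, abs_mul,
    abs_of_nonneg (sq_nonneg s)]
  ring

lemma excess_neg_of_mul_eq_zero {p : R3} (hz : p 2 = 0) (hp : p ≠ 0) (h : p 0 * p 1 = 0) :
    excess p < 0 := by
  have h2 : 0 < |p 0| + |p 1| := by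
    by_contra! h2
    have h0 : p 0 = 0 := abs_nonpos_iff.1 (by linarith [abs_nonneg (p 1)])
    have h1 : p 1 = 0 := abs_nonpos_iff.1 (by linarith [abs_nonneg (p 0)])
    exact hp (by funext k; fin_cases k <;> assumption)
  have := abs_fst_le_halfPerimeter (p 1) (p 0)
  have := abs_snd_le_halfPerimeter (p 1) (p 0)
  have := mul_pos h2 pi_pos
  rw [excess, h, abs_zero]
  linarith

lemma excess_nonpos_of_abs_lt {p : R3} (h : |p 0| < 1) : excess p ≤ 0 := by
  have h1 := abs_fst_le_halfPerimeter (p 1) (p 0)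
  have h2 : |p 0| * |p 1| ≤ 1 * |p 1| := by gcongr
  have h3 : |p 1| * 1 ≤ |p 1| * (π / 2) := by gcongr; linarith [pi_gt_three]
  rw [excess, abs_mul]
  linarith

lemma mem_bdry₀N_iff_excess {p : R3} : p ∈ bdry₀N ↔ p 2 = 0 ∧ p ≠ 0 ∧ excess p = 0 := by
  rw [mem_bdry₀N_iff]
  refine ⟨fun ⟨hz, h0, _, h⟩ => ⟨hz, fun hp => h0 (by simp [hp]), by rw [excess, h, sub_self]⟩,
    fun ⟨hz, hp, h⟩ => ?_⟩
  have h01 : p 0 * p 1 ≠ 0 := fun h' => (excess_neg_of_mul_eq_zero hz hp h').ne h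
  exact ⟨hz, left_ne_zero_of_mul h01, right_ne_zero_of_mul h01, (sub_eq_zero.1 h).symm⟩

/-- The points which `bdry₀N` separates from the origin are those of positive excess. The others
are joined to the origin by a radial segment, and the two kinds are separated by open sets since the
excess is not positive in a whole strip around the `y`-axis. -/
lemma mem_separated_iff {p : R3} : p ∈ separated ↔ p 2 = 0 ∧ 0 < excess p := by
  have hz : (0 : R3) ∈ plane \ bdry₀N := ⟨rfl, fun h => (mem_bdry₀N_iff_excess.1 h).2.1 rfl⟩
  constructor
  · rintro ⟨⟨hp2, hp⟩, hcomp⟩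
    refine ⟨hp2, ?_⟩
    by_contra! hle
    refine hcomp ?_
    have hp0 : p ≠ 0 := fun h => hcomp (by rw [h]; exact mem_connectedComponentIn hz)
    have hlt : excess p < 0 := hle.lt_of_ne fun h => hp (mem_bdry₀N_iff_excess.2 ⟨hp2, hp0, h⟩)
    have hseg : segment ℝ 0 p ⊆ plane \ bdry₀N := by
      rw [segment_eq_image]
      rintro _ ⟨s, ⟨hs0, hs1⟩, rfl⟩
      simp only [smul_zero, zero_add]
      rcases hs0.eq_or_lt with rfl | hs0
      · simpa using hz
      refine ⟨by simp [plane, show p 2 = 0 from hp2], fun h => ?_⟩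
      have h1 := (mem_bdry₀N_iff_excess.1 h).2.2
      rw [excess_smul hs0.le] at h1
      have h2 := mul_neg_of_pos_of_neg hs0 hlt
      have h3 : s * (s - 1) * |p 0 * p 1| ≤ 0 :=
        mul_nonpos_of_nonpos_of_nonneg
          (mul_nonpos_of_nonneg_of_nonpos hs0.le (by linarith)) (abs_nonneg _)
      linarith
    exact (convex_segment _ _).isPreconnected.subset_connectedComponentIn
      (left_mem_segment ℝ 0 p) hseg (right_mem_segment ℝ 0 p)
  · rintro ⟨hp2, hpos⟩
    refine ⟨⟨hp2, fun h => hpos.ne' (mem_bdry₀N_iff_excess.1 h).2.2⟩, fun hcomp => ?_⟩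
    have hU : IsOpen ({q : R3 | excess q < 0} ∪ {q | |q 0| < 1}) :=
      (isOpen_lt continuous_excess continuous_const).union
        (isOpen_lt (by fun_prop) continuous_const)
    have hV : IsOpen {q : R3 | 0 < excess q} := isOpen_lt continuous_const continuous_excess
    have hneg : ∀ q ∈ {q : R3 | excess q < 0} ∪ {q | |q 0| < 1}, excess q ≤ 0 := by
      rintro q (hq | hq)
      · exact hq.le
      · exact excess_nonpos_of_abs_lt hq
    have hsub := isPreconnected_connectedComponentIn.subset_left_of_subset_union
      (s := connectedComponentIn (plane \ bdry₀N) 0) hU hV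
      (disjoint_left.2 fun q hq hq' => (hneg q hq).not_gt hq')
      (fun q hq => by
        obtain ⟨hq2, hq⟩ := connectedComponentIn_subset _ _ hq
        rcases eq_or_ne q 0 with rfl | hq0
        · exact Or.inl (Or.inr (by simp))
        rcases lt_trichotomy (excess q) 0 with h | h | h
        · exact Or.inl (Or.inl h)
        · exact absurd (mem_bdry₀N_iff_excess.2 ⟨hq2, hq0, h⟩) hq
        · exact Or.inr h)
      ⟨0, mem_connectedComponentIn hz, Or.inr (by simp)⟩
    exact (hneg p (hsub hcomp)).not_gt hpos

lemma excess_nonneg_of_mem_bdryN {p : R3} (hp : p ∈ bdryN) : 0 ≤ excess p :=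
  closure_minimal (fun _ hq => (mem_separated_iff.1 hq).2.le)
    (isClosed_le continuous_const continuous_excess) hp

/-- Beyond each of its points, `bdry₀N` separates the ray from the origin. -/
lemma bdry₀N_subset_bdryN : bdry₀N ⊆ bdryN := fun p hp => by
  obtain ⟨hz, h0, h1, -⟩ := mem_bdry₀N_iff.1 hp
  have hE := (mem_bdry₀N_iff_excess.1 hp).2.2
  have hlim : Tendsto (fun s : ℝ => s • p) (𝓝[>] 1) (𝓝 p) := by
    have : Continuous fun s : ℝ => s • p := by fun_prop
    simpa using (this.tendsto 1).mono_left nhdsWithin_le_nhds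
  refine mem_closure_of_tendsto hlim ?_
  filter_upwards [self_mem_nhdsWithin] with s hs
  have hs : 1 < s := hs
  refine mem_separated_iff.2 ⟨by simp [hz], ?_⟩
  rw [excess_smul (by linarith), hE]
  have : 0 < s - 1 := by linarith
  positivity

lemma triangle_subset (a b : ℝ) (ha : 0 ≤ a) (hb : 0 ≤ b) :
    triangle a b ⊆ {q | q 0 ≤ a ∧ a * q 1 ≤ b * q 0 ∧ q 2 = 0} := by
  refine convexHull_min ?_ ?_
  · rintro q (rfl | rfl | rfl)
    · simp [ha]
    · simp [mul_nonneg hb ha]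
    · simp [mul_comm]
  · intro x hx y hy s t hs ht hst
    obtain ⟨hx0, hx1, hx2⟩ := hx
    obtain ⟨hy0, hy1, hy2⟩ := hy
    refine ⟨?_, ?_, by simp [hx2, hy2]⟩
    · simp only [Pi.add_apply, Pi.smul_apply, smul_eq_mul]
      calc s * x 0 + t * y 0 ≤ s * a + t * a := by gcongr
        _ = a := by rw [← add_mul, hst, one_mul]
    · simp only [Pi.add_apply, Pi.smul_apply, smul_eq_mul]
      linarith [mul_le_mul_of_nonneg_left hx1 hs, mul_le_mul_of_nonneg_left hy1 ht]

/-- The coordinate `x` on `bdry₀N` is a function of the slope: `x = halfPerimeter 1 (x / y)`. -/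
lemma excess_eq_mul {p : R3} (h0 : 0 < p 0) (h1 : 0 < p 1) :
    excess p = p 1 * (p 0 - halfPerimeter 1 (p 0 / p 1)) := by
  have h := halfPerimeter_mul (p 1) 1 (p 0 / p 1)
  rw [mul_one, mul_div_cancel₀ _ h1.ne', abs_of_pos h1] at h
  rw [excess, h, abs_of_pos (mul_pos h0 h1)]
  ring

end SolGeometry

/-- Triangle Avoidance: if `p = (a,b,0) ∈ ∂₀N₊` with `a > b > 0`, then `∂N₊ ∩ Δ(p) = {p}`. -/
theorem theorem3p1 (a b : ℝ) (hb : 0 < b) (hab : b < a)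
    (hp : (![a, b, 0] : SolGeometry.R3) ∈ SolGeometry.pos SolGeometry.bdry₀N) :
    SolGeometry.pos SolGeometry.bdryN ∩ SolGeometry.triangle a b = {![a, b, 0]} := by
  open SolGeometry in
  have ha : 0 < a := hb.trans hab
  have hE := (mem_bdry₀N_iff_excess.1 hp.1).2.2
  rw [excess_eq_mul hp.2.1 hp.2.2] at hE
  have hpa : a = halfPerimeter 1 (a / b) :=
    sub_eq_zero.1 ((mul_eq_zero.1 hE).resolve_left hb.ne')
  refine Set.Subset.antisymm ?_ ?_
  · rintro q ⟨⟨hq, hq0, hq1⟩, hqt⟩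
    obtain ⟨hqa, hqb, hq2⟩ := triangle_subset a b ha.le hb.le hqt
    have hqE := excess_nonneg_of_mem_bdryN hq
    rw [excess_eq_mul hq0 hq1] at hqE
    have hle : halfPerimeter 1 (q 0 / q 1) ≤ q 0 :=
      sub_nonneg.1 (nonneg_of_mul_nonneg_right hqE hq1)
    have hslope : a / b ≤ q 0 / q 1 := by
      rw [div_le_div_iff₀ hb hq1]; linarith
    -- if the slope of `q` were smaller than that of `p`, then `q` would lie beyond `x = a`
    have heq : a / b = q 0 / q 1 := hslope.eq_of_not_lt fun hlt =>
      absurd (halfPerimeter_lt (u := 1) (div_pos ha hb).le hlt) (by linarith)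
    have hx : q 0 = a := le_antisymm hqa (by rw [← heq, ← hpa] at hle; exact hle)
    have hy : q 1 = b := by
      rw [hx, div_eq_div_iff hb.ne' hq1.ne'] at heq
      exact mul_left_cancel₀ ha.ne' heq
    refine Set.mem_singleton_iff.2 ?_
    funext k
    fin_cases k
    · exact hx
    · exact hy
    · exact hq2
  · rintro _ rfl
    exact ⟨⟨bdry₀N_subset_bdryN hp.1, hp.2⟩, subset_convexHull ℝ _ (by simp)⟩
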